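/- All graphs are finite and simple. A graph $G$ is $5$-vertex-critical if $\chi(G)=5$ and $G-v$ is $4$-colorable for every vertex $v$ of $G$. Let $P_5$ be the path on five vertices, and let the bull be the graph obtained from a triangle by attaching one pendant vertex to each of two of its vertices. A graph is $(P_5,\text{bull})$-free if it has no induced subgraph isomorphic to $P_5$ or to the bull. Theorem. Up to isomorphism, there are only finitely many $5$-vertex-critical $(P_5,\text{bull})$-free graphs. -/

import Mathlib

namespace SimpleGraph

/-- `G` is `k`-vertex-critical: its chromatic number is `k`, and deleting any vertex leaves a
`(k - 1)`-colourable graph. For `k = 0` the graph has no vertices, so the second condition is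
void and the truncated subtraction does no harm. -/
def IsVertexCritical {V : Type*} (G : SimpleGraph V) (k : ℕ) : Prop :=
  G.chromaticNumber = k ∧ ∀ v : V, (G.induce {v}ᶜ).Colorable (k - 1)

/-- `G` is `H`-free: no induced subgraph of `G` is isomorphic to `H`. (Mathlib's
`SimpleGraph.Free` concerns subgraphs that need not be induced.) -/
def IndFree {V W : Type*} (H : SimpleGraph W) (G : SimpleGraph V) : Prop :=
  ¬ H.IsIndContained G

/-- The bull: the triangle `0, 1, 2` with two disjoint pendant edges `0 3` and `1 4`. -/
def bull : SimpleGraph (Fin 5) :=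
  fromEdgeSet {s(0, 1), s(0, 2), s(1, 2), s(0, 3), s(1, 4)}

end SimpleGraph

namespace SimpleGraph

variable {V : Type*} {G : SimpleGraph V}

/-! Excluding `P₅` and the bull is used only through `LaminarTraces`: two neighbourhoods that
properly overlap on a stable set yield one of these graphs as an induced subgraph.

The structural core is `IsPrime.colorable_two`: a prime graph with laminar traces and a stable
triple is bipartite. In the non-neighbourhood of a vertex `z`, a component that is not a clique
splits into two stable levels, according to the neighbours shared with `z`
(`IsPrime.exists_isTwoLevel`). Two such components, for suitable `z` and `d'`, form a module, hence
cover the graph, and their levels give the 2-colouring.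

Now partition a `(k + 1)`-vertex-critical graph into modules with prime quotient. A bipartite
quotient with three or more classes is impossible, because optimal colourings of the classes could
be combined into a `k`-colouring. So the quotient has no stable triple, and since deleting one
vertex leaves a `k`-colourable graph, there are at most `2 * k + 1` classes. Each class is itself
critical with a smaller chromatic number, so induction bounds the order. -/

/-- In every stable set, the neighbourhood traces of any two vertices are nested or disjoint. -/
def LaminarTraces (G : SimpleGraph V) : Prop :=
  ∀ ⦃x y z u w : V⦄, ¬G.Adj x y → ¬G.Adj y z → ¬G.Adj x z →
    G.Adj u x → G.Adj u y → ¬G.Adj u z → G.Adj w y → G.Adj w z → G.Adj w x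

/-! ### Modules, primality and components. -/

/-- No vertex outside `M` distinguishes two vertices of `M`. -/
def IsModule (G : SimpleGraph V) (M : Set V) : Prop :=
  ∀ v ∉ M, ∀ a ∈ M, ∀ b ∈ M, G.Adj v a → G.Adj v b

/-- Every module of `G` is trivial. -/
def IsPrime (G : SimpleGraph V) : Prop :=
  ∀ M : Set V, G.IsModule M → M.Subsingleton ∨ M = Set.univ

/-- The vertices that can be reached from `x` by walks whose later vertices lie in `U`. -/
def componentIn (G : SimpleGraph V) (U : Set V) (x : V) : Set V :=
  {y | Relation.ReflTransGen (fun a b => G.Adj a b ∧ b ∈ U) x y}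

theorem self_mem_componentIn {U : Set V} {x : V} : x ∈ G.componentIn U x :=
  Relation.ReflTransGen.refl

theorem mem_componentIn_of_adj {U : Set V} {x a b : V} (ha : a ∈ G.componentIn U x)
    (hab : G.Adj a b) (hb : b ∈ U) : b ∈ G.componentIn U x :=
  Relation.ReflTransGen.tail ha ⟨hab, hb⟩

theorem componentIn_subset {U : Set V} {x : V} (hx : x ∈ U) : G.componentIn U x ⊆ U := by
  intro y hy
  induction hy with
  | refl => exact hx
  | tail _ h _ => exact h.2

/-- A property that is not constant on a component changes along an edge of the component. -/
theorem exists_adj_of_componentIn {U : Set V} {x a b : V} (P : V → Prop)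
    (ha : a ∈ G.componentIn U x) (hb : b ∈ G.componentIn U x) (hPa : P a) (hPb : ¬P b) :
    ∃ c ∈ G.componentIn U x, ∃ d ∈ G.componentIn U x, G.Adj c d ∧ P c ∧ ¬P d := by
  by_contra! h
  have key : ∀ y ∈ G.componentIn U x, (P y ↔ P x) := by
    intro y hy
    induction hy with
    | refl => rfl
    | tail hc hcd ih =>
      rw [← ih]
      have hd := mem_componentIn_of_adj hc hcd.1 hcd.2
      exact ⟨h _ hd _ hc hcd.1.symm, h _ hc _ hd hcd.1⟩
  exact hPb ((key b hb).2 ((key a ha).1 hPa))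

/-- The vertices different from `z` and not adjacent to it. -/
def nonNeighborSet (G : SimpleGraph V) (z : V) : Set V := {x | x ≠ z ∧ ¬G.Adj x z}

theorem IsPrime.exists_distinguishing (hp : G.IsPrime) {M : Set V} {a b z : V} (ha : a ∈ M)
    (hb : b ∈ M) (hab : a ≠ b) (hz : z ∉ M) :
    ∃ v ∉ M, ∃ c ∈ M, ∃ d ∈ M, G.Adj v c ∧ ¬G.Adj v d := by
  by_contra! h
  rcases hp M h with h | h
  · exact hab (h ha hb)
  · exact hz (h ▸ Set.mem_univ z)

/-! ### Components of a non-neighbourhood under laminar traces. -/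

theorem LaminarTraces.commonNeighbors_eq (hG : G.LaminarTraces) {z a b c : V}
    (ha : ¬G.Adj a z) (hb : ¬G.Adj b z) (hc : ¬G.Adj c z)
    (hab : G.Adj a b) (hbc : G.Adj b c) (hac : ¬G.Adj a c) :
    G.commonNeighbors z a = G.commonNeighbors z c := by
  ext u
  simp only [mem_commonNeighbors]
  constructor
  -- On the stable set `{z, a, c}`, `b` has trace `{a, c}`, while the trace of `u` contains `z` and
  -- one of `a`, `c`; laminarity forces the other one.
  · rintro ⟨h1, h2⟩
    exact ⟨h1, (hG (fun h => hac h.symm) ha hc hbc hab.symm hb h2.symm h1.symm).symm⟩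
  · rintro ⟨h1, h2⟩
    exact ⟨h1, (hG hac hc ha hab.symm hbc hb h2.symm h1.symm).symm⟩

/-- On `{a, z, c}`, witnesses of the two failed inclusions would have the overlapping traces `{a,
z}` and `{z, c}`. -/
theorem LaminarTraces.commonNeighbors_subset_or (hG : G.LaminarTraces) {z a c : V}
    (ha : ¬G.Adj a z) (hc : ¬G.Adj c z) (hac : ¬G.Adj a c) :
    G.commonNeighbors z a ⊆ G.commonNeighbors z c ∨
      G.commonNeighbors z c ⊆ G.commonNeighbors z a := by
  by_contra! h
  obtain ⟨h1, h2⟩ := h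
  obtain ⟨u, hu, hu'⟩ := Set.not_subset.1 h1
  obtain ⟨w, hw, hw'⟩ := Set.not_subset.1 h2
  simp only [mem_commonNeighbors, not_and] at hu hu' hw hw'
  exact hw' hw.1 (hG ha (fun h => hc h.symm) hac hu.2.symm hu.1.symm
    (fun h => hu' hu.1 h.symm) hw.1.symm hw.2.symm).symm

/-- Distances inside a component of an induced subgraph are at most three. -/
theorem LaminarTraces.exists_short_walk (hG : G.LaminarTraces) {U : Set V} {x d y : V}
    (hd : d ∈ G.componentIn U x) (hy : y ∈ G.componentIn U x) :
    y = d ∨ G.Adj d y ∨ (∃ g ∈ G.componentIn U x, G.Adj d g ∧ G.Adj g y) ∨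
      ∃ g ∈ G.componentIn U x, ∃ g' ∈ G.componentIn U x,
        G.Adj d g ∧ G.Adj g g' ∧ G.Adj g' y := by
  by_contra hn
  obtain ⟨c, hc, c', hc', hcc', hP, hnP⟩ := exists_adj_of_componentIn
    (fun y => y = d ∨ G.Adj d y ∨ (∃ g ∈ G.componentIn U x, G.Adj d g ∧ G.Adj g y) ∨
      ∃ g ∈ G.componentIn U x, ∃ g' ∈ G.componentIn U x,
        G.Adj d g ∧ G.Adj g g' ∧ G.Adj g' y) hd hy (Or.inl rfl) hn
  push Not at hnP
  obtain ⟨-, h1, h2, h3⟩ := hnP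
  rcases hP with rfl | h | ⟨g, hg, hdg, hgc⟩ | ⟨g, hg, g', hg', hdg, hgg, hgc⟩
  · exact h1 hcc'
  · exact h2 c hc h hcc'
  · exact h3 g hg c hc hdg hgc hcc'
  -- Without a shortcut, `g` and `c` have the overlapping traces `{d, g'}` and `{g', c'}` on the
  -- stable set `{d, g', c'}`.
  · by_cases hdg' : G.Adj d g'
    · exact h3 g' hg' c hc hdg' hgc hcc'
    by_cases hg'c : G.Adj g' c'
    · exact h3 g hg g' hg' hdg hgg hg'c
    by_cases hdc : G.Adj d c
    · exact h2 c hc hdc hcc'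
    exact hdc (hG hdg' hg'c h1 hdg.symm hgg (fun h => h2 g hg hdg h) hgc.symm hcc').symm

/-- The set `C` splits into two stable levels according to the neighbours shared with `z`; `d` and
`e` lie in the upper level and `d'` in the lower one. -/
structure IsTwoLevel (G : SimpleGraph V) (z : V) (C : Set V) (d e d' : V) : Prop where
  mem_d : d ∈ C
  mem_e : e ∈ C
  mem_d' : d' ∈ C
  adj_ed' : G.Adj e d'
  not_adj : ¬G.Adj d d'
  eq_d : G.commonNeighbors z e = G.commonNeighbors z d
  ssubset : G.commonNeighbors z d' ⊂ G.commonNeighbors z d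
  levels : ∀ c ∈ C, G.commonNeighbors z c = G.commonNeighbors z d ∨
    G.commonNeighbors z c = G.commonNeighbors z d'
  proper : ∀ a ∈ C, ∀ b ∈ C, G.Adj a b → G.commonNeighbors z a ≠ G.commonNeighbors z b

/-- A component of the non-neighbourhood of `z` in a prime graph is a clique or has two levels. -/
theorem IsPrime.exists_isTwoLevel (hp : G.IsPrime) (hG : G.LaminarTraces) {z x w y : V}
    (hx : x ∈ G.nonNeighborSet z) (hw : w ∈ G.nonNeighborSet z) (hy : y ∈ G.nonNeighborSet z)
    (hxw : G.Adj x w) (hwy : G.Adj w y) (hxy : ¬G.Adj x y) (hne : x ≠ y) :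
    ∃ d e d', G.IsTwoLevel z (G.componentIn (G.nonNeighborSet z) w) d e d' := by
  set C := G.componentIn (G.nonNeighborSet z) w with hC
  have hCA : C ⊆ G.nonNeighborSet z := componentIn_subset hw
  have hwC : w ∈ C := self_mem_componentIn
  have hxC : x ∈ C := mem_componentIn_of_adj hwC hxw.symm hx
  have hyC : y ∈ C := mem_componentIn_of_adj hwC hwy hy
  have closed : ∀ {a b}, a ∈ C → G.Adj a b → b ∈ G.nonNeighborSet z → b ∈ C :=
    fun ha hab hb => mem_componentIn_of_adj ha hab hb
  have path : ∀ {a b c}, a ∈ C → b ∈ C → c ∈ C → G.Adj a b → G.Adj b c → ¬G.Adj a c →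
      G.commonNeighbors z a = G.commonNeighbors z c := fun ha hb hc =>
    hG.commonNeighbors_eq (hCA ha).2 (hCA hb).2 (hCA hc).2
  -- a vertex outside `C` with a neighbour in `C` is a neighbour of `z`
  have out : ∀ {v a}, v ∉ C → a ∈ C → G.Adj v a → G.Adj v z := by
    intro v a hv ha hva
    by_contra h
    refine hv (closed ha hva.symm ⟨?_, h⟩)
    rintro rfl
    exact (hCA ha).2 hva.symm
  obtain ⟨d, hd, d', hd', hdd', hss⟩ : ∃ d ∈ C, ∃ d' ∈ C, ¬G.Adj d d' ∧
      G.commonNeighbors z d' ⊂ G.commonNeighbors z d := by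
    -- `D` is a component of the complement of `G` within `C`. A vertex of `C` with a non-neighbour
    -- in `D` belongs to `D`, so whatever distinguishes `D` lies outside `C` and is adjacent to `z`.
    -- It then separates the two ends of some non-edge of `D`.
    set D := Gᶜ.componentIn C x with hD
    have hDC : D ⊆ C := componentIn_subset hxC
    have hzD : z ∉ D := fun h => (hCA (hDC h)).1 rfl
    have hxD : x ∈ D := self_mem_componentIn
    have hyD : y ∈ D := mem_componentIn_of_adj hxD (by simp [hne, hxy]) hyC
    obtain ⟨v, hv, a, ha, b, hb, hva, hvb⟩ := hp.exists_distinguishing hxD hyD hne hzD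
    have hvC : v ∉ C := fun h =>
      hv (mem_componentIn_of_adj hb (by
        rw [compl_adj]
        exact ⟨fun h => hv (h ▸ hb), fun h => hvb h.symm⟩) h)
    have hvz := out hvC (hDC ha) hva
    obtain ⟨c, hc, c', hc', hcc', h1, h2⟩ :=
      exists_adj_of_componentIn (fun t => G.Adj v t) ha hb hva hvb
    rw [compl_adj] at hcc'
    have hcC := hDC hc
    have hcC' := hDC hc'
    refine ⟨c, hcC, c', hcC', hcc'.2, ?_⟩
    have hvc : v ∈ G.commonNeighbors z c := ⟨hvz.symm, h1.symm⟩
    have hvc' : v ∉ G.commonNeighbors z c' := fun h => h2 h.2.symm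
    rcases hG.commonNeighbors_subset_or (hCA hcC).2 (hCA hcC').2 hcc'.2 with h | h
    · exact absurd (h hvc) hvc'
    · exact ⟨h, fun h => hvc' (h hvc)⟩
  have hne' : G.commonNeighbors z d ≠ G.commonNeighbors z d' := hss.ne'
  have nocommon : ∀ g ∈ C, G.Adj d g → ¬G.Adj g d' := fun g hg h1 h2 =>
    hne' (path hd hg hd' h1 h2 hdd')
  -- Ends of an induced two-edge path share the same neighbours with `z`, so `d` and `d'` are at
  -- distance exactly three.
  obtain ⟨e, he, e', he', hde, hee', hed'⟩ : ∃ e ∈ C, ∃ e' ∈ C,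
      G.Adj d e ∧ G.Adj e e' ∧ G.Adj e' d' := by
    rcases hG.exists_short_walk hd hd' with h | h | ⟨g, hg, h1, h2⟩ | h
    · exact absurd (h ▸ rfl) hne'
    · exact absurd h hdd'
    · exact absurd h2 (nocommon g hg h1)
    · exact h
  have eqd : G.commonNeighbors z e' = G.commonNeighbors z d :=
    (path hd he he' hde hee' fun h => nocommon e' he' h hed').symm
  have eqd' : G.commonNeighbors z e = G.commonNeighbors z d' :=
    path he he' hd' hee' hed' fun h => nocommon e he hde h
  have levels : ∀ c ∈ C, G.commonNeighbors z c = G.commonNeighbors z d ∨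
      G.commonNeighbors z c = G.commonNeighbors z d' := by
    have nbr : ∀ c ∈ C, G.Adj d c → G.commonNeighbors z c = G.commonNeighbors z d ∨
        G.commonNeighbors z c = G.commonNeighbors z d' := by
      -- A third value at a neighbour `c` of `d` would force `c` to be adjacent to `e`, then `e'`,
      -- then `d'`, making it a common neighbour of `d` and `d'`.
      intro c hc hdc
      by_contra! h
      have h1 : G.Adj c e := by
        by_contra hn
        exact h.2 ((path hc hd he hdc.symm hde hn).trans eqd')
      have h2 : G.Adj c e' := by
        by_contra hn
        exact h.1 ((path hc he he' h1 hee' hn).trans eqd)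
      have h3 : G.Adj c d' := by
        by_contra hn
        exact h.2 (path hc he' hd' h2 hed' hn)
      exact nocommon c hc hdc h3
    intro c hc
    by_cases hdc : G.Adj d c
    · exact nbr c hc hdc
    rcases hG.exists_short_walk hd hc with h | h | ⟨g, hg, h1, h2⟩ | ⟨g, hg, g', hg', h1, h2, h3⟩
    · exact Or.inl (h ▸ rfl)
    · exact nbr c hc h
    · exact Or.inl (path hd hg hc h1 h2 hdc).symm
    · by_cases hgc : G.Adj g c
      · exact Or.inl (path hd hg hc h1 hgc hdc).symm
      · rw [← path hg hg' hc h2 h3 hgc]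
        exact nbr g hg h1
  refine ⟨d, e', d', hd, he', hd', hed', hdd', eqd, hss, levels, ?_⟩
  intro a ha b hb hab heq
  -- An edge inside a level would make its component `K` within that level a nontrivial module: a
  -- vertex of `C` splitting an edge of `K` is in the same level, hence in `K`, and vertices outside
  -- `C` see all or none of a level.
  set L : Set V := {c | c ∈ C ∧ G.commonNeighbors z c = G.commonNeighbors z a} with hL
  set K := G.componentIn L a with hK
  have hKL : K ⊆ L := componentIn_subset ⟨ha, rfl⟩
  have haK : a ∈ K := self_mem_componentIn
  have hbK : b ∈ K := mem_componentIn_of_adj haK hab ⟨hb, heq.symm⟩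
  have hzK : z ∉ K := fun h => (hCA (hKL h).1).1 rfl
  obtain ⟨v, hv, p, hpK, q, hq, hvp, hvq⟩ := hp.exists_distinguishing haK hbK hab.ne hzK
  by_cases hvC : v ∈ C
  · obtain ⟨c, hc, c', hc', hcc', h1, h2⟩ :=
      exists_adj_of_componentIn (fun t => G.Adj v t) hpK hq hvp hvq
    have h3 := path hvC (hKL hc).1 (hKL hc').1 h1 hcc' h2
    exact hv (mem_componentIn_of_adj hpK hvp.symm ⟨hvC, h3.trans (hKL hc').2⟩)
  · have hvz := out hvC (hKL hpK).1 hvp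
    have h1 : v ∈ G.commonNeighbors z p := ⟨hvz.symm, hvp.symm⟩
    rw [(hKL hpK).2, ← (hKL hq).2] at h1
    exact hvq h1.2.symm

/-! ### Prime graphs with a stable triple. -/

/-- A prime graph with laminar traces that has three pairwise non-adjacent vertices is
bipartite. -/
theorem IsPrime.colorable_two (hp : G.IsPrime) (hG : G.LaminarTraces) {x y t : V}
    (hxy : x ≠ y) (hxt : x ≠ t) (hyt : y ≠ t) (axy : ¬G.Adj x y) (axt : ¬G.Adj x t)
    (ayt : ¬G.Adj y t) : G.Colorable 2 := by
  classical
  obtain ⟨z, p, q, u, hp1, hu1, hq1, hpu, huq, hpq, hpq'⟩ : ∃ z p q u, p ∈ G.nonNeighborSet z ∧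
      u ∈ G.nonNeighborSet z ∧ q ∈ G.nonNeighborSet z ∧ G.Adj p u ∧ G.Adj u q ∧ ¬G.Adj p q ∧
      p ≠ q := by
    have hyA : y ∈ G.nonNeighborSet x := ⟨hxy.symm, fun h => axy h.symm⟩
    have htA : t ∈ G.nonNeighborSet x := ⟨hxt.symm, fun h => axt h.symm⟩
    -- A vertex `v` distinguishing `D` is adjacent to `x` and separates a non-adjacent pair `c`,
    -- `c'` of `D`; then `x`, `v`, `c` is an induced path among the non-neighbours of `c'`.
    set D := Gᶜ.componentIn (G.nonNeighborSet x) y with hD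
    have hDA : D ⊆ G.nonNeighborSet x := componentIn_subset hyA
    have hxD : x ∉ D := fun h => (hDA h).1 rfl
    have hyD : y ∈ D := self_mem_componentIn
    have htD : t ∈ D := mem_componentIn_of_adj hyD (by simp [hyt, ayt]) htA
    obtain ⟨v, hv, a, ha, b, hb, hva, hvb⟩ := hp.exists_distinguishing hyD htD hyt hxD
    have hvx : G.Adj v x := by
      by_contra h
      refine hv (mem_componentIn_of_adj hb ?_ ⟨?_, h⟩)
      · rw [compl_adj]
        exact ⟨fun h => hv (h ▸ hb), fun h => hvb h.symm⟩
      · rintro rfl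
        exact (hDA ha).2 hva.symm
    obtain ⟨c, hc, c', hc', hcc', h1, h2⟩ :=
      exists_adj_of_componentIn (fun t => G.Adj v t) ha hb hva hvb
    rw [compl_adj] at hcc'
    refine ⟨c', x, c, v, ⟨fun h => (hDA hc').1 h.symm, fun h => (hDA hc').2 h.symm⟩,
      ⟨?_, h2⟩, ⟨hcc'.1, hcc'.2⟩, hvx.symm, h1, fun h => (hDA hc).2 h.symm,
      fun h => (hDA hc).1 h.symm⟩
    rintro rfl
    exact (hDA hc').2 hvx
  obtain ⟨d, e, d', T⟩ := hp.exists_isTwoLevel hG hp1 hu1 hq1 hpu huq hpq hpq'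
  set C := G.componentIn (G.nonNeighborSet z) u with hC
  have hCA : C ⊆ G.nonNeighborSet z := componentIn_subset hu1
  obtain ⟨b, hbd, hbd'⟩ := Set.exists_of_ssubset T.ssubset
  have azb : G.Adj z b := hbd.1
  have adb : G.Adj d b := hbd.2
  have abd' : ¬G.Adj b d' := fun h => hbd' ⟨azb, h.symm⟩
  have azd' : ¬G.Adj z d' := fun h => (hCA T.mem_d').2 h.symm
  have hzd' : z ≠ d' := fun h => (hCA T.mem_d').1 h.symm
  have hz2 : z ∈ G.nonNeighborSet d' := ⟨hzd', azd'⟩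
  have hb2 : b ∈ G.nonNeighborSet d' := ⟨fun h => azd' (h ▸ azb), abd'⟩
  have hd2 : d ∈ G.nonNeighborSet d' := ⟨fun h => T.ssubset.ne (h ▸ rfl), T.not_adj⟩
  have azd : ¬G.Adj z d := fun h => (hCA T.mem_d).2 h.symm
  -- The roles of `z` and `d'` are now exchanged: `z`, `b`, `d` is an induced path in the
  -- non-neighbourhood of `d'`.
  obtain ⟨r, _, r', T'⟩ := hp.exists_isTwoLevel hG hz2 hb2 hd2 azb adb.symm azd
    (fun h => (hCA T.mem_d).1 h.symm)
  set C' := G.componentIn (G.nonNeighborSet d') b with hC'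
  have hCA' : C' ⊆ G.nonNeighborSet d' := componentIn_subset hb2
  have hbC' : b ∈ C' := self_mem_componentIn
  have hzC' : z ∈ C' := mem_componentIn_of_adj hbC' azb.symm hz2
  have full : ∀ c ∈ C, ∀ v, v ∈ G.commonNeighbors z d' → G.Adj v c := by
    intro c hc v hv
    rcases T.levels c hc with h | h
    · exact (h ▸ T.ssubset.1 hv : v ∈ G.commonNeighbors z c).2.symm
    · exact (h ▸ hv : v ∈ G.commonNeighbors z c).2.symm
  -- If `z` were in the upper level of `C'`, its neighbour `b` would be in the lower one, and `e`,
  -- shared by `b` and `d'`, would be adjacent to `z`.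
  have lower : G.commonNeighbors d' z = G.commonNeighbors d' r' := by
    refine (T'.levels z hzC').resolve_left fun h => ?_
    have hb' := (T'.levels b hbC').resolve_left fun h' => T'.proper z hzC' b hbC' azb (h.trans h'.symm)
    have hbe : e ∈ G.commonNeighbors d' b :=
      ⟨T.adj_ed'.symm, (T.eq_d ▸ hbd : b ∈ G.commonNeighbors z e).2.symm⟩
    rw [hb'] at hbe
    have h2 := T'.ssubset.1 hbe
    rw [← h] at h2
    exact (hCA T.mem_e).2 h2.2.symm
  have full' : ∀ c ∈ C', ∀ v, v ∈ G.commonNeighbors z d' → G.Adj v c := by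
    intro c hc v hv
    rw [commonNeighbors_symm, lower] at hv
    rcases T'.levels c hc with h | h
    · exact (h ▸ T'.ssubset.1 hv : v ∈ G.commonNeighbors d' c).2.symm
    · exact (h ▸ hv : v ∈ G.commonNeighbors d' c).2.symm
  have nbrC' : ∀ v, G.Adj z v → v ∉ G.commonNeighbors z d' → v ∈ C' := fun v hzv hv =>
    mem_componentIn_of_adj hzC' hzv ⟨fun h => azd' (h ▸ hzv), fun h => hv ⟨hzv, h.symm⟩⟩
  have closed : ∀ m ∈ C ∪ C', ∀ v, v ∉ G.commonNeighbors z d' → G.Adj v m → v ∈ C ∪ C' := by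
    rintro m (hm | hm) v hv hvm
    · by_cases hzv : G.Adj z v
      · exact Or.inr (nbrC' v hzv hv)
      · refine Or.inl (mem_componentIn_of_adj hm hvm.symm ⟨?_, fun h => hzv h.symm⟩)
        rintro rfl
        exact (hCA hm).2 hvm.symm
    · by_cases hvd' : G.Adj v d'
      · by_cases hzv : G.Adj z v
        · exact absurd ⟨hzv, hvd'.symm⟩ hv
        · exact Or.inl (mem_componentIn_of_adj T.mem_d' hvd'.symm
            ⟨fun h => azd' (h ▸ hvd'), fun h => hzv h.symm⟩)
      · by_cases hvd : v = d'
        · exact Or.inl (hvd ▸ T.mem_d')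
        · exact Or.inr (mem_componentIn_of_adj hm hvm.symm ⟨hvd, hvd'⟩)
  -- Common neighbours of `z` and `d'` are complete to `C ∪ C'`, and no other outside vertex has a
  -- neighbour there.
  have hmod : G.IsModule (C ∪ C') := by
    intro v hv a ha c hc hva
    by_cases hvY : v ∈ G.commonNeighbors z d'
    · exact hc.elim (fun h => full c h v hvY) (fun h => full' c h v hvY)
    · exact absurd (closed a ha v hvY hva) hv
  have huniv : C ∪ C' = Set.univ := by
    refine (hp _ hmod).resolve_left fun h => azb.ne (h (Or.inr hzC') (Or.inr hbC'))
  have mem' : ∀ v, v ∉ C → v ∈ C' := fun v hv =>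
    (huniv ▸ Set.mem_univ v : v ∈ C ∪ C').resolve_left hv
  -- an edge leaving `C` joins the upper level of `C` to a neighbour of `z`
  have cross : ∀ v w, v ∈ C → w ∉ C → G.Adj v w →
      G.commonNeighbors z v = G.commonNeighbors z d ∧
        G.commonNeighbors d' w ≠ G.commonNeighbors d' z := by
    intro v w hv hw hvw
    have hzw : G.Adj z w := by
      by_contra h
      refine hw (mem_componentIn_of_adj hv hvw ⟨?_, fun h' => h h'.symm⟩)
      rintro rfl
      exact (hCA hv).2 hvw
    have hwC' := mem' w hw
    refine ⟨(T.levels v hv).resolve_right fun h => ?_,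
      (T'.proper z hzC' w hwC' hzw).symm⟩
    have h1 : w ∈ G.commonNeighbors z v := ⟨hzw, hvw⟩
    rw [h] at h1
    exact (hCA' hwC').2 h1.2.symm
  -- The colours match across the boundary: an edge leaving `C` joins its upper level to the upper
  -- level of `C'`, so upper is `true` on `C` and lower is `true` off `C`.
  let col : V → Bool := fun v =>
    if v ∈ C then decide (G.commonNeighbors z v = G.commonNeighbors z d)
    else decide (G.commonNeighbors d' v = G.commonNeighbors d' z)
  refine (Coloring.mk col ?_).colorable
  intro v w hvw
  simp only [col]
  by_cases hv : v ∈ C <;> by_cases hw : w ∈ C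
  · simp only [hv, hw, if_true, ne_eq, decide_eq_decide]
    intro h
    have h1 := T.proper v hv w hw hvw
    rcases T.levels v hv with h2 | h2 <;> rcases T.levels w hw with h3 | h3 <;> simp_all
  · have := cross v w hv hw hvw
    simp [hv, hw, this.1, this.2]
  · have := cross w v hw hv hvw.symm
    simp [hv, hw, this.1, this.2]
  · simp only [hv, hw, if_false, ne_eq, decide_eq_decide, lower]
    have h1 := T'.proper v (mem' v hv) w (mem' w hw) hvw
    rcases T'.levels v (mem' v hv) with h2 | h2 <;>
      rcases T'.levels w (mem' w hw) with h3 | h3 <;> simp_all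
    · exact T'.ssubset.ne'

/-! ### Colourings of vertex subsets and criticality. -/

/-- The subgraph induced on `U` has a proper colouring with colours from `T`. -/
def ColorableOn (G : SimpleGraph V) (U : Set V) (T : Finset ℕ) : Prop :=
  ∃ c : V → ℕ, (∀ v ∈ U, c v ∈ T) ∧ ∀ v ∈ U, ∀ w ∈ U, G.Adj v w → c v ≠ c w

theorem ColorableOn.mono {U U' : Set V} {T : Finset ℕ} (h : G.ColorableOn U T) (hU : U' ⊆ U) :
    G.ColorableOn U' T := by
  obtain ⟨c, h1, h2⟩ := h
  exact ⟨c, fun v hv => h1 v (hU hv), fun v hv w hw => h2 v (hU hv) w (hU hw)⟩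

theorem ColorableOn.of_card_le {U : Set V} {T T' : Finset ℕ} (h : G.ColorableOn U T)
    (hT : T.card ≤ T'.card) : G.ColorableOn U T' := by
  classical
  obtain ⟨c, h1, h2⟩ := h
  obtain ⟨e⟩ : Nonempty (T ↪ T') := Function.Embedding.nonempty_of_card_le (by simpa using hT)
  refine ⟨fun v => if hv : c v ∈ T then e ⟨c v, hv⟩ else 0, fun v hv => ?_, fun v hv w hw hvw => ?_⟩
  · simp [h1 v hv]
  · simp only [h1 v hv, h1 w hw, dif_pos]
    intro h
    have := e.injective (Subtype.ext h)
    exact h2 v hv w hw hvw (congrArg Subtype.val this)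

/-- A proper colouring of `U` colours each subset with the colours that occur on it. -/
theorem colorableOn_image [Finite V] {U K : Set V} {c : V → ℕ} (hK : K ⊆ U)
    (hc : ∀ v ∈ U, ∀ w ∈ U, G.Adj v w → c v ≠ c w) :
    G.ColorableOn K (Set.toFinite (c '' K)).toFinset :=
  ⟨c, fun v hv => by simpa using ⟨v, hv, rfl⟩, fun v hv w hw => hc v (hK hv) w (hK hw)⟩

theorem colorable_induce_iff {U : Set V} {n : ℕ} :
    (G.induce U).Colorable n ↔ G.ColorableOn U (Finset.range n) := by
  classical
  rw [colorable_iff_exists_bdd_nat_coloring]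
  constructor
  · rintro ⟨C, hC⟩
    refine ⟨fun v => if h : v ∈ U then C ⟨v, h⟩ else 0, fun v hv => ?_, fun v hv w hw hvw => ?_⟩
    · simpa [hv] using hC ⟨v, hv⟩
    · simp only [hv, hw, dif_pos]
      exact C.valid (v := ⟨v, hv⟩) (w := ⟨w, hw⟩) hvw
  · rintro ⟨c, h1, h2⟩
    exact ⟨Coloring.mk (fun v => c v) (fun {v w} hvw => h2 v v.2 w w.2 hvw),
      fun v => Finset.mem_range.1 (h1 v v.2)⟩

/-- The subgraph induced on `U` is `(k + 1)`-vertex-critical. -/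
def IsCriticalOn (G : SimpleGraph V) (U : Set V) (k : ℕ) : Prop :=
  ¬G.ColorableOn U (Finset.range k) ∧ ∀ v ∈ U, G.ColorableOn (U \ {v}) (Finset.range k)

/-- Let `j + 1` be the chromatic number of the module `K`. If some `K \ {v}` needed `j + 1` colours,
a `k`-colouring of `U \ {v}` would use at least that many on it, and `K` could be recoloured from
that palette. Outside neighbours of `K` see all of `K`, so they avoid the palette and `U` would be
`k`-colourable. -/
theorem IsCriticalOn.exists_isCriticalOn_module [Finite V] {U K : Set V} {k : ℕ}
    (hU : G.IsCriticalOn U k) (hKU : K ⊆ U) (hne : K.Nonempty) {u : V} (hu : u ∈ U) (huK : u ∉ K)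
    (hmod : ∀ v ∈ U, v ∉ K → ∀ a ∈ K, ∀ b ∈ K, G.Adj v a → G.Adj v b) :
    ∃ j < k, G.IsCriticalOn K j := by
  classical
  have hk : ∃ m, G.ColorableOn K (Finset.range m) :=
    ⟨k, (hU.2 u hu).mono fun v hv => ⟨hKU hv, fun h => huK (h ▸ hv)⟩⟩
  obtain ⟨m, hm, hmin⟩ : ∃ m, G.ColorableOn K (Finset.range m) ∧
      ∀ n, G.ColorableOn K (Finset.range n) → m ≤ n :=
    ⟨Nat.find hk, Nat.find_spec hk, fun n hn => Nat.find_min' hk hn⟩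
  have hmk : m ≤ k := hmin k ((hU.2 u hu).mono fun v hv => ⟨hKU hv, fun h => huK (h ▸ hv)⟩)
  obtain ⟨j, rfl⟩ : ∃ j, m = j + 1 := by
    refine Nat.exists_eq_succ_of_ne_zero ?_
    rintro rfl
    obtain ⟨c, h1, -⟩ := hm
    obtain ⟨v, hv⟩ := hne
    simpa using h1 v hv
  refine ⟨j, by omega, fun h => by have := hmin j h; omega, fun v hv => ?_⟩
  by_contra hj
  obtain ⟨c, h1, h2⟩ := hU.2 v (hKU hv)
  have hsub : K \ {v} ⊆ U \ {v} := Set.sdiff_subset_sdiff_left hKU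
  set T := (Set.toFinite (c '' (K \ {v}))).toFinset with hT
  have hTm : j + 1 ≤ T.card := by
    by_contra h
    exact hj ((colorableOn_image hsub h2).of_card_le
      (by rw [Finset.card_range]; exact Nat.le_of_lt_succ (not_le.1 h)))
  obtain ⟨g, g1, g2⟩ := hm.of_card_le (T' := T) (by simpa using hTm)
  have hTk : ∀ t ∈ T, t ∈ Finset.range k := by
    intro t ht
    simp only [hT, Set.Finite.mem_toFinset] at ht
    obtain ⟨a, ha, rfl⟩ := ht
    exact h1 a (hsub ha)
  have cross : ∀ a ∈ K, ∀ b ∈ U, b ∉ K → G.Adj a b → g a ≠ c b := by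
    intro a ha b hb hbK hab heq
    have := g1 a ha
    rw [heq] at this
    simp only [hT, Set.Finite.mem_toFinset] at this
    obtain ⟨a', ha', hc⟩ := this
    exact h2 a' (hsub ha') b ⟨hb, fun h => hbK (h ▸ hv)⟩
      (hmod b hb hbK a ha a' ha'.1 hab.symm).symm hc
  refine hU.1 ⟨fun a => if a ∈ K then g a else c a, fun a ha => ?_, fun a ha b hb hab => ?_⟩
  · by_cases haK : a ∈ K
    · simpa [haK] using hTk _ (g1 a haK)
    · simpa [haK] using h1 a ⟨ha, fun h => haK (h ▸ hv)⟩
  · by_cases haK : a ∈ K <;> by_cases hbK : b ∈ K <;> simp only [haK, hbK, if_true, if_false]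
    · exact g2 a haK b hbK hab
    · exact cross a haK b hb hbK hab
    · exact (cross b hbK a ha haK hab.symm).symm
    · exact h2 a ⟨ha, fun h => haK (h ▸ hv)⟩ b ⟨hb, fun h => hbK (h ▸ hv)⟩ hab

/-! ### Modular partitions and their quotients. -/

/-- `f` sends each vertex of `U` to the representative of its class in a partition of `U` into
modules. -/
structure IsModularRetraction (G : SimpleGraph V) (U : Set V) (f : V → V) : Prop where
  mem : ∀ v ∈ U, f v ∈ U
  idem : ∀ v ∈ U, f (f v) = f v
  adj_iff : ∀ v ∈ U, ∀ w ∈ U, f v ≠ f w → (G.Adj v w ↔ G.Adj (f v) (f w))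

theorem LaminarTraces.induce (hG : G.LaminarTraces) (U : Set V) :
    (G.induce U).LaminarTraces := fun _ _ _ _ _ h1 h2 h3 h4 h5 h6 h7 h8 =>
  hG h1 h2 h3 h4 h5 h6 h7 h8

/-- A set with at least two vertices has a modular partition with at least two classes and prime
quotient. -/
theorem exists_isModularRetraction_isPrime [Finite V] {U : Set V} (hU : U.Nontrivial) :
    ∃ f, G.IsModularRetraction U f ∧ (f '' U).Nontrivial ∧ (G.induce (f '' U)).IsPrime := by
  classical
  -- Take the fewest classes subject to having at least two: a nontrivial module of the quotient
  -- could be contracted to give fewer.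
  have hex : ∃ n, ∃ f, G.IsModularRetraction U f ∧ (f '' U).Nontrivial ∧ (f '' U).ncard = n :=
    ⟨_, id, ⟨fun _ h => h, fun _ _ => rfl, fun _ _ _ _ _ => Iff.rfl⟩, by simpa using hU, rfl⟩
  obtain ⟨f, hf, hnt, hn⟩ := Nat.find_spec hex
  refine ⟨f, hf, hnt, fun M hM => ?_⟩
  by_contra! hcon
  obtain ⟨hM1, hM2⟩ := hcon
  obtain ⟨⟨a, haR⟩, ha, ⟨b, hbR⟩, hb, hab⟩ := hM1
  obtain ⟨⟨r, hrR⟩, hr⟩ := (Set.ne_univ_iff_exists_notMem M).1 hM2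
  have hab' : a ≠ b := fun h => hab (Subtype.ext h)
  set M' : Set V := Subtype.val '' M with hM'
  have memM' : ∀ x (hx : x ∈ f '' U), x ∈ M' ↔ (⟨x, hx⟩ : f '' U) ∈ M := by
    intro x hx
    simp only [hM', Set.mem_image, Subtype.exists, exists_and_right, exists_eq_right]
    exact ⟨fun ⟨_, h⟩ => h, fun h => ⟨hx, h⟩⟩
  have haM := (memM' a haR).2 ha
  have hbM := (memM' b hbR).2 hb
  have hrM : r ∉ M' := fun h => hr ((memM' r hrR).1 h)
  have fix : ∀ x ∈ f '' U, f x = x := by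
    rintro x ⟨y, hy, rfl⟩
    exact hf.idem y hy
  have sub : ∀ x ∈ f '' U, x ∈ U := by
    rintro x ⟨y, hy, rfl⟩
    exact hf.mem y hy
  have mod : ∀ x ∈ f '' U, x ∉ M' → ∀ y ∈ M', ∀ z ∈ M', G.Adj x y → G.Adj x z := by
    rintro x hx hxM y ⟨y', hy', rfl⟩ z ⟨z', hz', rfl⟩ hxy
    exact hM ⟨x, hx⟩ (fun h => hxM ((memM' x hx).2 h)) y' hy' z' hz' hxy
  let f' : V → V := fun v => if f v ∈ M' then a else f v
  have f'in : ∀ v, f v ∈ M' → f' v = a := fun v h => if_pos h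
  have f'out : ∀ v, f v ∉ M' → f' v = f v := fun v h => if_neg h
  have key : ∀ v ∈ U, ∀ w ∈ U, f v ∈ M' → f w ∉ M' → (G.Adj v w ↔ G.Adj a (f w)) := by
    intro v hv w hw hvM hwM
    rw [hf.adj_iff v hv w hw fun h => hwM (h ▸ hvM), G.adj_comm, G.adj_comm a]
    exact ⟨mod _ ⟨w, hw, rfl⟩ hwM _ hvM _ haM, mod _ ⟨w, hw, rfl⟩ hwM _ haM _ hvM⟩
  have hf' : G.IsModularRetraction U f' := by
    refine ⟨fun v hv => ?_, fun v hv => ?_, fun v hv w hw hvw => ?_⟩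
    · by_cases h : f v ∈ M'
      · rw [f'in v h]
        exact sub a haR
      · rw [f'out v h]
        exact hf.mem v hv
    · by_cases h : f v ∈ M'
      · rw [f'in v h, f'in a (by rwa [fix a haR])]
      · rw [f'out v h, f'out (f v) (by rwa [hf.idem v hv]), hf.idem v hv]
    · by_cases h : f v ∈ M' <;> by_cases h' : f w ∈ M'
      · exact absurd ((f'in v h).trans (f'in w h').symm) hvw
      · rw [f'in v h, f'out w h']
        exact key v hv w hw h h'
      · rw [f'in w h', f'out v h, G.adj_comm, G.adj_comm (f v)]
        exact key w hw v hv h' h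
      · rw [f'out v h, f'out w h'] at hvw ⊢
        exact hf.adj_iff v hv w hw hvw
  have hsub : f' '' U ⊆ f '' U := by
    rintro _ ⟨v, hv, rfl⟩
    by_cases h : f v ∈ M'
    · rwa [f'in v h]
    · rw [f'out v h]
      exact ⟨v, hv, rfl⟩
  have hb' : b ∉ f' '' U := by
    rintro ⟨v, hv, hvb⟩
    by_cases h : f v ∈ M'
    · exact hab' ((f'in v h).symm.trans hvb)
    · rw [f'out v h] at hvb
      exact h (hvb ▸ hbM)
  have hlt : (f' '' U).ncard < (f '' U).ncard :=
    Set.ncard_lt_ncard ⟨hsub, fun h => hb' (h hbR)⟩ (Set.toFinite _)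
  rw [hn] at hlt
  refine Nat.find_min hex hlt ⟨f', hf', ⟨a, ⟨a, sub a haR, ?_⟩, r, ⟨r, sub r hrR, ?_⟩, ?_⟩, rfl⟩
  · exact f'in a (by rwa [fix a haR])
  · rw [f'out r (by rwa [fix r hrR]), fix r hrR]
  · exact fun h => hrM (h ▸ haM)

/-- If the quotient of `U` by a modular partition is bipartite with at least three classes, then
`U` is not critical. -/
theorem IsCriticalOn.not_colorable_two [Finite V] {U : Set V} {k : ℕ} (hU : G.IsCriticalOn U k)
    {f : V → V} (hf : G.IsModularRetraction U f)
    (hthree : ∀ r s, ∃ t ∈ f '' U, t ≠ r ∧ t ≠ s) : ¬(G.induce (f '' U)).Colorable 2 := by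
  classical
  rw [colorable_induce_iff]
  rintro ⟨b, hb2, hb⟩
  have fix : ∀ x ∈ f '' U, f x = x := by
    rintro x ⟨y, hy, rfl⟩
    exact hf.idem y hy
  have sub : ∀ x ∈ f '' U, x ∈ U := by
    rintro x ⟨y, hy, rfl⟩
    exact hf.mem y hy
  let K : V → Set V := fun r => {v | v ∈ U ∧ f v = r}
  have hK : ∀ r, ∀ t ∈ f '' U, t ≠ r → K r ⊆ U \ {t} := by
    rintro r t ht htr v ⟨hv, rfl⟩
    exact ⟨hv, fun h => htr (by rw [Set.mem_singleton_iff.1 h, fix t ht])⟩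
  have hKk : ∀ r, G.ColorableOn (K r) (Finset.range k) := by
    intro r
    obtain ⟨t, ht, htr, -⟩ := hthree r r
    exact (hU.2 t (sub t ht)).mono (hK r t ht htr)
  have hmin : ∀ r, ∃ m, G.ColorableOn (K r) (Finset.range m) ∧
      ∀ n, G.ColorableOn (K r) (Finset.range n) → m ≤ n := fun r =>
    have h : ∃ m, G.ColorableOn (K r) (Finset.range m) := ⟨k, hKk r⟩
    ⟨Nat.find h, Nat.find_spec h, fun n hn => Nat.find_min' h hn⟩
  choose m hm hmmin using hmin
  choose g g1 g2 using hm
  have hmk : ∀ r, m r ≤ k := fun r => hmmin r k (hKk r)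
  -- Deleting the representative of a third class leaves the classes of `r` and `s` intact; in a
  -- `k`-colouring of the rest their palettes are disjoint.
  have hsum : ∀ r ∈ f '' U, ∀ s ∈ f '' U, G.Adj r s → m r + m s ≤ k := by
    intro r hr s hs hrs
    obtain ⟨t, ht, htr, hts⟩ := hthree r s
    obtain ⟨c, c1, c2⟩ := hU.2 t (sub t ht)
    have hle : ∀ q, t ≠ q → m q ≤ (Set.toFinite (c '' K q)).toFinset.card := fun q hq =>
      hmmin q _ ((colorableOn_image (hK q t ht hq) c2).of_card_le (by simp))
    have hdisj : Disjoint (Set.toFinite (c '' K r)).toFinset (Set.toFinite (c '' K s)).toFinset := by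
      rw [Finset.disjoint_left]
      simp only [Set.Finite.mem_toFinset]
      rintro _ ⟨v, hv, rfl⟩ ⟨w, hw, hwv⟩
      have hne : f v ≠ f w := by rw [hv.2, hw.2]; exact hrs.ne
      refine c2 v (hK r t ht htr hv) w (hK s t ht hts hw) ?_ hwv.symm
      rw [hf.adj_iff v hv.1 w hw.1 hne, hv.2, hw.2]
      exact hrs
    have hsub : (Set.toFinite (c '' K r)).toFinset ∪ (Set.toFinite (c '' K s)).toFinset ⊆
        Finset.range k := by
      intro x hx
      simp only [Finset.mem_union, Set.Finite.mem_toFinset] at hx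
      rcases hx with ⟨v, hv, rfl⟩ | ⟨v, hv, rfl⟩
      · exact c1 v (hK r t ht htr hv)
      · exact c1 v (hK s t ht hts hv)
    have := Finset.card_le_card hsub
    rw [Finset.card_union_of_disjoint hdisj, Finset.card_range] at this
    have := hle r htr
    have := hle s hts
    omega
  have gm : ∀ v ∈ U, g (f v) v < m (f v) := fun v hv => by
    simpa using g1 (f v) v ⟨hv, rfl⟩
  -- One side of the bipartition takes its colours from the bottom of `range k`, the other from the
  -- top; `hsum` keeps adjacent classes apart.
  refine hU.1 ⟨fun v => if b (f v) = 0 then g (f v) v else k - 1 - g (f v) v,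
    fun v hv => ?_, fun v hv w hw hvw => ?_⟩
  · have := gm v hv
    have := hmk (f v)
    rw [Finset.mem_range]
    dsimp only
    split_ifs <;> omega
  · have hv' := gm v hv
    have hw' := gm w hw
    have hmv := hmk (f v)
    have hmw := hmk (f w)
    by_cases h : f v = f w
    · have := g2 (f v) v ⟨hv, rfl⟩ w ⟨hw, h.symm⟩ hvw
      dsimp only
      rw [← h] at hw' ⊢
      split_ifs <;> omega
    · have hadj := (hf.adj_iff v hv w hw h).1 hvw
      have hfv : f v ∈ f '' U := ⟨v, hv, rfl⟩
      have hfw : f w ∈ f '' U := ⟨w, hw, rfl⟩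
      have h1 := hb _ hfv _ hfw hadj
      have h2 := Finset.mem_range.1 (hb2 _ hfv)
      have h3 := Finset.mem_range.1 (hb2 _ hfw)
      have h4 := hsum _ hfv _ hfw hadj
      dsimp only
      split_ifs <;> omega

/-! ### Bounding the order of critical graphs. -/

/-- An upper bound for the order of a `(k + 1)`-vertex-critical graph with laminar traces. -/
def criticalOrderBound : ℕ → ℕ
  | 0 => 1
  | k + 1 => criticalOrderBound k * (2 * k + 3)

/-- Quantifying over all `j ≤ k` lets the induction hypothesis apply to classes whose chromatic
number drops by more than one. -/
theorem IsCriticalOn.ncard_le_of_le [Finite V] (hG : G.LaminarTraces) (k : ℕ) :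
    ∀ j ≤ k, ∀ U : Set V, G.IsCriticalOn U j → U.ncard ≤ criticalOrderBound k := by
  classical
  induction k with
  | zero =>
    intro j hj U hU
    obtain rfl : j = 0 := by omega
    refine (Set.ncard_le_one (Set.toFinite _)).2 fun a ha b hb => ?_
    by_contra hab
    obtain ⟨c, h1, -⟩ := hU.2 a ha
    simpa using h1 b ⟨hb, fun h => hab h.symm⟩
  | succ k ih =>
    intro j hj U hU
    by_cases hnt : U.Nontrivial
    swap
    · rw [Set.not_nontrivial_iff] at hnt
      have h1 : U.ncard ≤ 1 := (Set.ncard_le_one (Set.toFinite _)).2 fun a ha b hb => hnt ha hb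
      have h2 : ∀ n, 0 < criticalOrderBound n := by
        intro n
        induction n with
        | zero => simp [criticalOrderBound]
        | succ n ihn => simp [criticalOrderBound, ihn]
      exact h1.trans (h2 _)
    obtain ⟨f, hf, hR, hprime⟩ := exists_isModularRetraction_isPrime (G := G) hnt
    have sub : f '' U ⊆ U := by
      rintro x ⟨y, hy, rfl⟩
      exact hf.mem y hy
    have notriad : ∀ x ∈ f '' U, ∀ y ∈ f '' U, ∀ t ∈ f '' U, x ≠ y → x ≠ t → y ≠ t →
        ¬G.Adj x y → ¬G.Adj x t → ¬G.Adj y t → False := by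
      intro x hx y hy t ht hxy hxt hyt axy axt ayt
      refine hU.not_colorable_two hf (fun r s => ?_)
        (hprime.colorable_two (hG.induce _) (x := ⟨x, hx⟩) (y := ⟨y, hy⟩) (t := ⟨t, ht⟩)
          (by simpa using hxy) (by simpa using hxt) (by simpa using hyt) axy axt ayt)
      by_contra! h
      rcases eq_or_ne x r with rfl | hx'
      · exact hyt ((h y hy hxy.symm).trans (h t ht hxt.symm).symm)
      · obtain rfl := h x hx hx'
        rcases eq_or_ne y r with rfl | hy'
        · exact hxt (h t ht hyt.symm).symm
        · exact hxy (h y hy hy').symm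
    have hcard : (f '' U).ncard ≤ 2 * k + 3 := by
      obtain ⟨r, hr⟩ := hR.nonempty
      obtain ⟨c, c1, c2⟩ := hU.2 r (sub hr)
      -- Each of the `j ≤ k + 1` colours occurs on at most two representatives, since three would
      -- form a stable triple.
      have h1 : ((f '' U) \ {r}).ncard ≤ 2 * (k + 1) := by
        rw [Set.ncard_eq_toFinset_card _ (Set.toFinite _)]
        set s := (Set.toFinite ((f '' U) \ {r})).toFinset with hs
        have hmem : ∀ x, x ∈ s ↔ x ∈ (f '' U) \ {r} := fun x => by simp [hs]
        refine (Finset.card_le_mul_card_image_of_maps_to (f := c) (t := Finset.range j)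
          (fun x hx => c1 x ?_) 2 fun i _ => ?_).trans ?_
        · exact ⟨sub ((hmem x).1 hx).1, ((hmem x).1 hx).2⟩
        · by_contra! h
          obtain ⟨x, y, t, hx, hy, ht, hxy, hxt, hyt⟩ := Finset.two_lt_card_iff.1 h
          simp only [Finset.mem_filter, hmem] at hx hy ht
          have na : ∀ p q, (p ∈ (f '' U) \ {r} ∧ c p = i) → (q ∈ (f '' U) \ {r} ∧ c q = i) →
              ¬G.Adj p q := fun p q hp hq hpq =>
            c2 p ⟨sub hp.1.1, hp.1.2⟩ q ⟨sub hq.1.1, hq.1.2⟩ hpq (hp.2.trans hq.2.symm)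
          exact notriad x hx.1.1 y hy.1.1 t ht.1.1 hxy hxt hyt (na _ _ hx hy) (na _ _ hx ht)
            (na _ _ hy ht)
        · rw [Finset.card_range]
          omega
      have h2 := Set.ncard_sdiff_singleton_add_one hr (Set.toFinite _)
      omega
    have hfib : ∀ r ∈ f '' U, {v | v ∈ U ∧ f v = r}.ncard ≤ criticalOrderBound k := by
      rintro r ⟨v, hv, hvr⟩
      obtain ⟨s, hs, hsr⟩ := hR.exists_ne r
      obtain ⟨s', hs', hfs⟩ := hs
      obtain ⟨i, hi, hcrit⟩ := hU.exists_isCriticalOn_module (K := {v | v ∈ U ∧ f v = r})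
        (fun _ h => h.1) ⟨v, hv, hvr⟩ hs' (fun h => hsr (hfs.symm.trans h.2)) (by
          rintro w hw hwK a ⟨ha, har⟩ b ⟨hb, hbr⟩ hwa
          have hwr : f w ≠ r := fun h => hwK ⟨hw, h⟩
          rw [hf.adj_iff w hw b hb (by rwa [hbr]), hbr, ← har]
          exact (hf.adj_iff w hw a ha (by rwa [har])).1 hwa)
      exact ih i (by omega) _ hcrit
    rw [Set.ncard_eq_toFinset_card _ (Set.toFinite U)]
    set s := (Set.toFinite U).toFinset with hs
    have himg : (s.image f).card ≤ 2 * k + 3 := by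
      refine le_trans (le_of_eq ?_) hcard
      rw [← Set.ncard_coe_finset]
      simp [hs]
    refine (Finset.card_le_mul_card_image s (criticalOrderBound k) fun r hr => ?_).trans
      (Nat.mul_le_mul_left _ himg)
    obtain ⟨v, hv, hvr⟩ := Finset.mem_image.1 hr
    refine le_trans (le_of_eq ?_) (hfib r ⟨v, by simpa [hs] using hv, hvr⟩)
    rw [← Set.ncard_coe_finset]
    simp [hs]

/-! ### From forbidden induced subgraphs to laminar traces. -/

theorem laminarTraces_of_indFree (hP : (pathGraph 5).IndFree G) (hB : bull.IndFree G) :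
    G.LaminarTraces := by
  intro x y z u w hxy hyz hxz hux huy huz hwy hwz
  by_contra hwx
  have hyx : ¬G.Adj y x := fun h => hxy h.symm
  have hzy : ¬G.Adj z y := fun h => hyz h.symm
  have hzx : ¬G.Adj z x := fun h => hxz h.symm
  have hzu : ¬G.Adj z u := fun h => huz h.symm
  have hxw : ¬G.Adj x w := fun h => hwx h.symm
  have n1 : x ≠ y := fun h => hwx (h ▸ hwy)
  have n2 : x ≠ z := fun h => huz (h ▸ hux)
  have n3 : y ≠ z := fun h => huz (h ▸ huy)
  have n4 : u ≠ w := fun h => huz (h ▸ hwz)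
  have n5 : u ≠ z := fun h => hzy (h ▸ huy)
  have n6 : w ≠ x := fun h => hxy (h ▸ hwy)
  -- If `u` and `w` are adjacent, the triangle `u`, `w`, `y` with pendants `x`, `z` is a bull;
  -- otherwise `x`, `u`, `y`, `w`, `z` is an induced `P₅`.
  by_cases huw : G.Adj u w
  · refine hB ⟨⟨⟨![u, w, y, x, z], ?_⟩, ?_⟩⟩
    · intro i j hij
      fin_cases i <;> fin_cases j <;> first | rfl | (exfalso; revert hij; simp [n1, n2, n3, n4, n5,
        n6, n1.symm, n2.symm, n3.symm, n4.symm, n5.symm, n6.symm, hux.ne, hux.ne', huy.ne, huy.ne',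
        hwy.ne, hwy.ne', hwz.ne, hwz.ne'])
    · intro i j
      change G.Adj (![u, w, y, x, z] i) (![u, w, y, x, z] j) ↔ _
      fin_cases i <;> fin_cases j <;> simp [bull, hux, hux.symm, huy, huy.symm, hwy, hwy.symm, hwz,
        hwz.symm, huw, huw.symm, hxy, hyx, hyz, hzy, hxz, hzx, huz, hzu, hwx, hxw]
  · have hwu : ¬G.Adj w u := fun h => huw h.symm
    refine hP ⟨⟨⟨![x, u, y, w, z], ?_⟩, ?_⟩⟩
    · intro i j hij
      fin_cases i <;> fin_cases j <;> first | rfl | (exfalso; revert hij; simp [n1, n2, n3, n4, n5,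
        n6, n1.symm, n2.symm, n3.symm, n4.symm, n5.symm, n6.symm, hux.ne, hux.ne', huy.ne, huy.ne',
        hwy.ne, hwy.ne', hwz.ne, hwz.ne'])
    · intro i j
      change G.Adj (![x, u, y, w, z] i) (![x, u, y, w, z] j) ↔ _
      fin_cases i <;> fin_cases j <;> simp [pathGraph_adj, hux, hux.symm, huy, huy.symm, hwy,
        hwy.symm, hwz, hwz.symm, huw, hwu, hxy, hyx, hyz, hzy, hxz, hzx, huz, hzu, hwx, hxw]

theorem IsVertexCritical.isCriticalOn_univ {k : ℕ} (h : G.IsVertexCritical (k + 1)) :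
    G.IsCriticalOn Set.univ k := by
  refine ⟨fun hc => ?_, fun v _ => ?_⟩
  · obtain ⟨c, h1, h2⟩ := hc
    have : G.Colorable k := (colorable_iff_exists_bdd_nat_coloring k).2
      ⟨Coloring.mk c fun {v w} => h2 v trivial w trivial, fun v => Finset.mem_range.1 (h1 v trivial)⟩
    have := chromaticNumber_le_iff_colorable.2 this
    rw [h.1] at this
    have : k + 1 ≤ k := by exact_mod_cast this
    omega
  · rw [← Set.compl_eq_univ_sdiff]
    exact colorable_induce_iff.1 (h.2 v)

end SimpleGraph

/-- Up to isomorphism there are only finitely many finite `5`-vertex-critical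
`(P₅, bull)`-free graphs. -/
theorem mainTheorem1 :
    ∃ F : Set (Σ n : ℕ, SimpleGraph (Fin n)), F.Finite ∧
      ∀ (V : Type*) [Finite V] (G : SimpleGraph V),
        G.IsVertexCritical 5 →
        (SimpleGraph.pathGraph 5).IndFree G →
        SimpleGraph.bull.IndFree G →
        ∃ H ∈ F, Nonempty (G ≃g H.2) := by
  refine ⟨⋃ n ∈ Set.Iic (SimpleGraph.criticalOrderBound 4), Set.range (Sigma.mk n),
    (Set.finite_Iic _).biUnion fun _ _ => Set.finite_range _, fun V _ G hG hP hB => ?_⟩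
  have hcard := SimpleGraph.IsCriticalOn.ncard_le_of_le
    (SimpleGraph.laminarTraces_of_indFree hP hB) 4 4 le_rfl _ hG.isCriticalOn_univ
  rw [Set.ncard_univ] at hcard
  exact ⟨⟨Nat.card V, G.map (Finite.equivFin V).toEmbedding⟩, Set.mem_biUnion hcard ⟨_, rfl⟩,
    ⟨SimpleGraph.Iso.map (Finite.equivFin V) G⟩⟩
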